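/- Let $\mathcal{A}$ be an abelian category. A \emph{subcategory} of $\mathcal{A}$ means a full additive subcategory that is closed under isomorphisms. For a subcategory $\mathcal{X}$ of $\mathcal{A}$, a complex $X=\cdots\to X_1\xrightarrow{\partial_1}X_0\xrightarrow{\partial_0}X_{-1}\to\cdots$ of objects of $\mathcal{X}$ is \emph{totally $\mathcal{X}$-acyclic} if it is exact and the complexes of abelian groups $\operatorname{Hom}_{\mathcal{A}}(X',X)$ and $\operatorname{Hom}_{\mathcal{A}}(X,X')$ are exact for every object $X'$ of $\mathcal{X}$. Let $\mathcal{G}(\mathcal{X})$ be the subcategory of $\mathcal{A}$ whose objects are the objects $M\cong\operatorname{Coker}(\partial_1)$ for some totally $\mathcal{X}$-acyclic complex $X$. Set $\mathcal{G}^0(\mathcal{X})=\mathcal{X}$, $\mathcal{G}^1(\mathcal{X})=\mathcal{G}(\mathcal{X})$ and $\mathcal{G}^{n+1}(\mathcal{X})=\mathcal{G}(\mathcal{G}^n(\mathcal{X}))$ for $n\geq 1$. \textbf{Corollary.} Let $\mathcal{W}$ be a subcategory of $\mathcal{A}$ such that $\operatorname{Ext}^i_{\mathcal{A}}(W,W')=0$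 for all objects $W,W'$ of $\mathcal{W}$ and all $i\geq 1$. Then $\mathcal{G}^n(\mathcal{W})=\mathcal{G}(\mathcal{W})$ for every $n\geq 1$. -/

import Mathlib

open CategoryTheory CategoryTheory.Limits CategoryTheory.Abelian

universe w v u

namespace GorensteinSubcategory

variable {C : Type u} [Category.{v} C] [Abelian C]

/-- A subcategory, in the sense used here: the object property of a full additive subcategory
that is closed under isomorphisms. As the subcategory is full, additivity means that it contains
the zero objects and the (bi)products of any two of its objects. -/
structure IsSubcategory (X : ObjectProperty C) : Prop where
  closedUnderIsomorphisms : X.IsClosedUnderIsomorphisms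
  zero_mem : ∀ Z : C, IsZero Z → X Z
  biprod_mem : ∀ A B : C, X A → X B → X (A ⊞ B)

/-- `X ⊥ Y`: one has `Ext ^ i (A, B) = 0` for all `A` in `X`, all `B` in `Y` and all `i ≥ 1`.
These are the Ext-groups of an arbitrary abelian category (morphisms in the derived category).
The class `HasExt.{w} C` only selects a universe in which they are realized: it holds in every
abelian category for `w = max u v` (`HasExt.standard`). -/
def Perp [HasExt.{w} C] (X Y : ObjectProperty C) : Prop :=
  ∀ A B : C, X A → Y B → ∀ i : ℕ, 1 ≤ i → Subsingleton (Ext.{w} A B i)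

/-- The complex of abelian groups `Hom(A, K)`, for an object `A` and a complex `K`. -/
noncomputable abbrev homFrom (A : C) (K : ChainComplex C ℤ) :
    HomologicalComplex AddCommGrpCat.{v} (ComplexShape.down ℤ) :=
  ((preadditiveCoyoneda.obj (Opposite.op A)).mapHomologicalComplex _).obj K

/-- The complex of abelian groups `Hom(K, A)`, for a complex `K` and an object `A`. -/
noncomputable abbrev homTo (K : ChainComplex C ℤ) (A : C) :
    HomologicalComplex AddCommGrpCat.{v} (ComplexShape.down ℤ).symm :=
  ((preadditiveYoneda.obj A).mapHomologicalComplex _).obj K.op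

/-- A totally `X`-acyclic complex: an exact unbounded complex
`⋯ ⟶ K₁ ⟶ K₀ ⟶ K₋₁ ⟶ ⋯` of objects of `X`, which is `Hom(X, -)`-exact and `Hom(-, X)`-exact. -/
structure IsTotallyAcyclic (X : ObjectProperty C) (K : ChainComplex C ℤ) : Prop where
  mem : ∀ i : ℤ, X (K.X i)
  exact : K.Acyclic
  homFrom_exact : ∀ A : C, X A → (homFrom A K).Acyclic
  homTo_exact : ∀ A : C, X A → (homTo K A).Acyclic

/-- The Gorenstein subcategory `G(X)`: the objects isomorphic to the cokernel of
`∂₁ : K₁ ⟶ K₀` for some totally `X`-acyclic complex `K`. -/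
def gorenstein (X : ObjectProperty C) : ObjectProperty C :=
  fun M => ∃ K : ChainComplex C ℤ, IsTotallyAcyclic X K ∧ Nonempty (M ≅ cokernel (K.d 1 0))

/-- The iterates `G^0(X) = X` and `G^(n+1)(X) = G(G^n(X))`; in particular `G^1(X) = G(X)`. -/
def gorensteinIter (X : ObjectProperty C) : ℕ → ObjectProperty C
  | 0 => X
  | n + 1 => gorenstein (gorensteinIter X n)

end GorensteinSubcategory

/-!
# Stability of Gorenstein subcategories

The proof shows `G(G(X)) = G(X)` for a subcategory `X`, from which the claim follows by induction.
It works with Hom-exactness alone. Call a short exact sequence `X`-proper if it stays exact under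
`Hom(T, -)` and `Hom(-, T)` for all `T` in `X`. Cutting totally `X`-acyclic complexes into short
exact sequences and splicing them back shows that an object lies in `G(X)` if and only if it has
an `X`-proper coresolution and an `X`-proper resolution by objects of `X`
(`gorenstein_iff_coresolvable`). Resolutions are coresolutions in `Cᵒᵖ`, so only coresolutions
need attention.

Since `X ≤ G(X)`, an object of `G(G(X))` has an `X`-proper coresolution by objects which
themselves have `X`-proper coresolutions by objects of `X`. Two constructions turn it into one by
objects of `X` (`coresolvable_coresolvable_le`): the Noether isomorphism for composites of proper
monomorphisms (`IsProper.exists_comp`), and a horseshoe lemma (`IsProper.exists_horseshoe`), which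
also shows that coresolvable objects are closed under proper extensions. Having a coresolution is
a coinductive property (`le_coresolvable`), so each of these needs to be carried out for a single
step only.
-/

namespace GorensteinSubcategory

open Opposite ZeroObject

variable {C : Type u} [Category.{v} C] [Abelian C]

/-! ### Proper short exact sequences -/

/-- `0 ⟶ A ⟶ B ⟶ D ⟶ 0` is a short exact sequence which stays exact under `Hom(T, -)` and
`Hom(-, T)` for every `T` in `X`. This notion is self-dual. -/
structure IsProper (X : ObjectProperty C) {A B D : C} (f : A ⟶ B) (g : B ⟶ D) : Prop where
  zero : f ≫ g = 0
  shortExact : (ShortComplex.mk f g zero).ShortExact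
  lift : ∀ T : C, X T → ∀ t : T ⟶ D, ∃ s : T ⟶ B, s ≫ g = t
  extend : ∀ T : C, X T → ∀ t : A ⟶ T, ∃ s : B ⟶ T, f ≫ s = t

namespace IsProper

variable {X : ObjectProperty C} {A B D : C} {f : A ⟶ B} {g : B ⟶ D}

lemma mono (h : IsProper X f g) : Mono f := h.shortExact.mono_f

lemma epi (h : IsProper X f g) : Epi g := h.shortExact.epi_g

lemma exists_lift_kernel (h : IsProper X f g) {T : C} (x : T ⟶ B) (hx : x ≫ g = 0) :
    ∃ y : T ⟶ A, y ≫ f = x :=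
  have := h.mono
  ⟨h.shortExact.exact.lift x hx, h.shortExact.exact.lift_f x hx⟩

lemma exists_desc_cokernel (h : IsProper X f g) {T : C} (x : B ⟶ T) (hx : f ≫ x = 0) :
    ∃ y : D ⟶ T, g ≫ y = x :=
  have := h.epi
  ⟨h.shortExact.exact.desc x hx, h.shortExact.exact.g_desc x hx⟩

lemma of_desc [Mono f] [Epi g] (zero : f ≫ g = 0)
    (desc : ∀ (T : C) (x : B ⟶ T), f ≫ x = 0 → ∃ y : D ⟶ T, g ≫ y = x)
    (lift : ∀ T : C, X T → ∀ t : T ⟶ D, ∃ s : T ⟶ B, s ≫ g = t)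
    (extend : ∀ T : C, X T → ∀ t : A ⟶ T, ∃ s : B ⟶ T, f ≫ s = t) : IsProper X f g where
  zero := zero
  shortExact :=
    { exact := ShortComplex.exact_of_g_is_cokernel _ (CokernelCofork.IsColimit.ofπ _ _
        (fun x hx => (desc _ x hx).choose) (fun x hx => (desc _ x hx).choose_spec)
        (fun x hx m hm => by
          rw [← cancel_epi g]
          exact hm.trans (desc _ x hx).choose_spec.symm))
      mono_f := ‹_›
      epi_g := ‹_› }
  lift := lift
  extend := extend

lemma cokernel_π [Mono f] (lift : ∀ T : C, X T → ∀ t : T ⟶ cokernel f,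
      ∃ s : T ⟶ B, s ≫ cokernel.π f = t)
    (extend : ∀ T : C, X T → ∀ t : A ⟶ T, ∃ s : B ⟶ T, f ≫ s = t) :
    IsProper X f (cokernel.π f) :=
  of_desc (cokernel.condition f)
    (fun _ x hx => ⟨cokernel.desc f x hx, cokernel.π_desc f x hx⟩) lift extend

lemma op (h : IsProper X f g) : IsProper X.op g.op f.op where
  zero := by rw [← op_comp, h.zero, op_zero]
  shortExact := h.shortExact.op
  lift T hT t := by
    obtain ⟨s, hs⟩ := h.extend T.unop hT t.unop
    exact ⟨s.op, Quiver.Hom.unop_inj hs⟩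
  extend T hT t := by
    obtain ⟨s, hs⟩ := h.lift T.unop hT t.unop
    exact ⟨s.op, Quiver.Hom.unop_inj hs⟩

lemma unop {X : ObjectProperty C} {A B D : Cᵒᵖ} {f : A ⟶ B} {g : B ⟶ D}
    (h : IsProper X.op f g) : IsProper X g.unop f.unop where
  zero := by rw [← unop_comp, h.zero, unop_zero]
  shortExact := h.shortExact.unop
  lift T hT t := by
    obtain ⟨s, hs⟩ := h.extend (Opposite.op T) hT t.op
    exact ⟨s.unop, Quiver.Hom.op_inj hs⟩
  extend T hT t := by
    obtain ⟨s, hs⟩ := h.lift (Opposite.op T) hT t.op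
    exact ⟨s.unop, Quiver.Hom.op_inj hs⟩

lemma anti {X' : ObjectProperty C} (hX : X' ≤ X) (h : IsProper X f g) : IsProper X' f g where
  zero := h.zero
  shortExact := h.shortExact
  lift T hT := h.lift T (hX T hT)
  extend T hT := h.extend T (hX T hT)

lemma iso_comp (h : IsProper X f g) {A' : C} (e : A' ≅ A) : IsProper X (e.hom ≫ f) g :=
  have := h.mono
  have := h.epi
  of_desc (by rw [Category.assoc, h.zero, comp_zero])
    (fun _ x hx => h.exists_desc_cokernel x
      (by rwa [Category.assoc, Preadditive.IsIso.comp_left_eq_zero] at hx))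
    h.lift
    (fun T hT t => by
      obtain ⟨s, hs⟩ := h.extend T hT (e.inv ≫ t)
      exact ⟨s, by rw [Category.assoc, hs, e.hom_inv_id_assoc]⟩)

lemma id_zero (X : ObjectProperty C) (A : C) {Z : C} (hZ : IsZero Z) :
    IsProper X (𝟙 A) (0 : A ⟶ Z) :=
  have : Epi (0 : A ⟶ Z) := ⟨fun _ _ _ => hZ.eq_of_src _ _⟩
  of_desc comp_zero
    (fun _ x hx => ⟨0, by rw [comp_zero, ← hx, Category.id_comp]⟩)
    (fun _ _ _ => ⟨0, hZ.eq_of_tgt _ _⟩)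
    (fun _ _ t => ⟨t, Category.id_comp t⟩)

/-- Noether's isomorphism for proper sequences: given proper sequences `M ⟶ Y ⟶ N` and
`Y ⟶ V ⟶ Q`, the composite `M ⟶ V` begins a proper sequence, and its cokernel is an extension of
`Q` by `N` via a proper sequence. -/
lemma exists_comp {M Y N V Q : C} {m : M ⟶ Y} {n : Y ⟶ N} {a : Y ⟶ V} {b : V ⟶ Q}
    (h : IsProper X m n) (h' : IsProper X a b) :
    ∃ (U : C) (c : V ⟶ U) (k : N ⟶ U) (q : U ⟶ Q),
      IsProper X (m ≫ a) c ∧ IsProper X k q := by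
  have := h.mono
  have := h.epi
  have := h'.mono
  have := h'.epi
  let c := cokernel.π (m ≫ a)
  have hmac : m ≫ a ≫ c = 0 := by rw [← Category.assoc]; exact cokernel.condition _
  obtain ⟨k, hk⟩ := h.exists_desc_cokernel (a ≫ c) hmac
  let q : cokernel (m ≫ a) ⟶ Q := cokernel.desc _ b (by rw [Category.assoc, h'.zero, comp_zero])
  have hq : c ≫ q = b := cokernel.π_desc _ _ _
  have : Epi q := epi_of_epi_fac hq
  have : Mono k := by
    refine Preadditive.mono_of_cancel_zero _ fun {T} x hx => ?_
    obtain ⟨T', e, _, y, hy⟩ := surjective_up_to_refinements_of_epi n x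
    have hyac : (y ≫ a) ≫ c = 0 := by
      rw [Category.assoc, ← hk, ← Category.assoc, ← hy, Category.assoc, hx, comp_zero]
    let z : T' ⟶ M := Abelian.monoLift (m ≫ a) (y ≫ a) hyac
    have hz : z ≫ m ≫ a = y ≫ a := Abelian.monoLift_comp _ _ _
    have hzy : z ≫ m = y := by
      rw [← cancel_mono a, Category.assoc, hz]
    rw [← cancel_epi e, hy, ← hzy, Category.assoc, h.zero, comp_zero, comp_zero]
  have hkq : IsProper X k q := by
    refine of_desc ?_ (fun T x hx => ?_) (fun T hT t => ?_) (fun T hT t => ?_)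
    · rw [← cancel_epi n, ← Category.assoc, hk, Category.assoc, hq, h'.zero, comp_zero]
    · obtain ⟨y, hy⟩ := h'.exists_desc_cokernel (c ≫ x)
        (by rw [← Category.assoc, ← hk, Category.assoc, hx, comp_zero])
      exact ⟨y, by rw [← cancel_epi c, ← Category.assoc, hq, hy]⟩
    · obtain ⟨s, hs⟩ := h'.lift T hT t
      exact ⟨s ≫ c, by rw [Category.assoc, hq, hs]⟩
    · obtain ⟨s, hs⟩ := h'.extend T hT (n ≫ t)
      refine ⟨cokernel.desc _ s
        (by rw [Category.assoc, hs, ← Category.assoc, h.zero, zero_comp]), ?_⟩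
      rw [← cancel_epi n, ← Category.assoc, hk, Category.assoc, cokernel.π_desc, hs]
  refine ⟨_, c, k, q, cokernel_π (fun T hT t => ?_) (fun T hT t => ?_), hkq⟩
  · -- Lift `t ≫ q` to `V`. The difference with `t` dies in `Q`, so it factors through `N`,
    -- where it can be lifted to `Y`.
    obtain ⟨s, hs⟩ := h'.lift T hT (t ≫ q)
    obtain ⟨r, hr⟩ := hkq.exists_lift_kernel (t - s ≫ c)
      (by rw [Preadditive.sub_comp, Category.assoc, hq, hs, sub_self])
    obtain ⟨y, rfl⟩ := h.lift T hT r
    refine ⟨y ≫ a + s, ?_⟩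
    rw [Category.assoc, hk] at hr
    change (y ≫ a + s) ≫ c = t
    rw [Preadditive.add_comp, Category.assoc, hr, sub_add_cancel]
  · obtain ⟨s, rfl⟩ := h.extend T hT t
    obtain ⟨r, rfl⟩ := h'.extend T hT s
    exact ⟨r, Category.assoc _ _ _⟩

/-- The horseshoe lemma for proper sequences. As `V` lies in `X`, the map `A ⟶ V` extends to `B`
by properness of `A ⟶ B ⟶ D`; no vanishing of `Ext` is needed. -/
lemma exists_horseshoe {A B D V A₁ V' D₁ : C} {i : A ⟶ B} {p : B ⟶ D} {a : A ⟶ V} {a' : V ⟶ A₁}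
    {d : D ⟶ V'} {d' : V' ⟶ D₁} (hS : IsProper X i p) (hA : IsProper X a a')
    (hD : IsProper X d d') (hV : X V) :
    ∃ (B₁ : C) (φ : B ⟶ V ⊞ V') (c : V ⊞ V' ⟶ B₁) (m : A₁ ⟶ B₁) (q : B₁ ⟶ D₁),
      IsProper X φ c ∧ IsProper X m q := by
  have := hS.mono
  have := hS.epi
  have := hA.mono
  have := hA.epi
  have := hD.mono
  have := hD.epi
  obtain ⟨e, he⟩ := hS.extend V hV a
  let φ : B ⟶ V ⊞ V' := biprod.lift e (p ≫ d)
  have hφfst : φ ≫ biprod.fst = e := biprod.lift_fst _ _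
  have hφsnd : φ ≫ biprod.snd = p ≫ d := biprod.lift_snd _ _
  have hiφ : i ≫ φ = a ≫ biprod.inl := by
    ext
    · simp [hφfst, he]
    · rw [Category.assoc, hφsnd, ← Category.assoc, hS.zero]
      simp
  let c := cokernel.π φ
  have hφc : φ ≫ c = 0 := cokernel.condition φ
  have : Mono φ := by
    refine Preadditive.mono_of_cancel_zero _ fun {T} x hx => ?_
    have hxp : x ≫ p = 0 := by
      rw [← cancel_mono d, Category.assoc, ← hφsnd, ← Category.assoc, hx, zero_comp, zero_comp]
    obtain ⟨y, rfl⟩ := hS.exists_lift_kernel x hxp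
    have hy : y = 0 := by
      rw [← cancel_mono a, ← he, ← hφfst, ← Category.assoc i, ← Category.assoc,
        ← Category.assoc, hx, zero_comp, zero_comp]
    rw [hy, zero_comp]
  obtain ⟨m, hm⟩ := hA.exists_desc_cokernel (biprod.inl ≫ c)
    (by rw [← Category.assoc, ← hiφ, Category.assoc, hφc, comp_zero])
  let q : cokernel φ ⟶ D₁ := cokernel.desc φ (biprod.snd ≫ d')
    (by rw [← Category.assoc, hφsnd, Category.assoc, hD.zero, comp_zero])
  have hq : c ≫ q = biprod.snd ≫ d' := cokernel.π_desc _ _ _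
  have : Epi q := epi_of_epi_fac hq
  have : Mono m := by
    refine Preadditive.mono_of_cancel_zero _ fun {T} x hx => ?_
    obtain ⟨T', ε, _, v, hv⟩ := surjective_up_to_refinements_of_epi a' x
    have hvc : (v ≫ biprod.inl) ≫ c = 0 := by
      rw [Category.assoc, ← hm, ← Category.assoc, ← hv, Category.assoc, hx, comp_zero]
    obtain ⟨b, hb⟩ : ∃ b : T' ⟶ B, b ≫ φ = v ≫ biprod.inl :=
      ⟨Abelian.monoLift φ _ hvc, Abelian.monoLift_comp _ _ _⟩
    have hbp : b ≫ p = 0 := by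
      rw [← cancel_mono d, Category.assoc, ← hφsnd, ← Category.assoc, hb]
      simp
    obtain ⟨y, rfl⟩ := hS.exists_lift_kernel b hbp
    have hya : y ≫ a = v := by
      have h := hb =≫ biprod.fst
      rwa [Category.assoc, Category.assoc, Category.assoc, hφfst, he, biprod.inl_fst,
        Category.comp_id] at h
    rw [← cancel_epi ε, hv, ← hya, Category.assoc, hA.zero, comp_zero, comp_zero]
  have hmq : IsProper X m q := by
    refine of_desc ?_ (fun T x hx => ?_) (fun T hT t => ?_) (fun T hT t => ?_)
    · rw [← cancel_epi a', ← Category.assoc, hm, Category.assoc, hq]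
      simp
    · have hinl : biprod.inl ≫ c ≫ x = 0 := by
        rw [← Category.assoc, ← hm, Category.assoc, hx, comp_zero]
      have hsnd : c ≫ x = biprod.snd ≫ biprod.inr ≫ c ≫ x := by
        ext
        · simp [hinl]
        · simp
      obtain ⟨y, hy⟩ := hD.exists_desc_cokernel (biprod.inr ≫ c ≫ x) (by
        rw [← cancel_epi p, ← Category.assoc p, ← hφsnd, Category.assoc, ← hsnd,
          ← Category.assoc, hφc, zero_comp, comp_zero])
      exact ⟨y, by rw [← cancel_epi c, ← Category.assoc, hq, Category.assoc, hy, ← hsnd]⟩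
    · obtain ⟨s, hs⟩ := hD.lift T hT t
      exact ⟨s ≫ biprod.inr ≫ c, by rw [Category.assoc, Category.assoc, hq]; simpa using hs⟩
    · -- `e ≫ a' ≫ t` vanishes on `A`, hence is induced from `D` and extends to `V'`; subtracting
      -- this extension on `V'` makes `a' ≫ t` on `V` vanish on `B`.
      obtain ⟨r, hr⟩ := hS.exists_desc_cokernel (e ≫ a' ≫ t)
        (by rw [← Category.assoc, he, ← Category.assoc, hA.zero, zero_comp])
      obtain ⟨r', rfl⟩ := hD.extend T hT r
      refine ⟨cokernel.desc φ (biprod.desc (a' ≫ t) (-r')) (by simp [φ, hr]), ?_⟩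
      rw [← cancel_epi a', ← Category.assoc, hm, Category.assoc, cokernel.π_desc,
        biprod.inl_desc]
  refine ⟨_, φ, c, m, q, cokernel_π (fun T hT t => ?_) (fun T hT t => ?_), hmq⟩
  · obtain ⟨s, hs⟩ := hD.lift T hT (t ≫ q)
    obtain ⟨r, hr⟩ := hmq.exists_lift_kernel (t - s ≫ biprod.inr ≫ c)
      (by rw [Preadditive.sub_comp, Category.assoc, Category.assoc, hq]; simp [hs])
    obtain ⟨y, rfl⟩ := hA.lift T hT r
    refine ⟨y ≫ biprod.inl + s ≫ biprod.inr, ?_⟩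
    rw [Category.assoc, hm] at hr
    change (y ≫ biprod.inl + s ≫ biprod.inr) ≫ c = t
    rw [Preadditive.add_comp, Category.assoc, hr, Category.assoc, sub_add_cancel]
  · obtain ⟨s, hs⟩ := hA.extend T hT (i ≫ t)
    obtain ⟨r, hr⟩ := hS.exists_desc_cokernel (t - e ≫ s)
      (by rw [Preadditive.comp_sub, ← Category.assoc, he, hs, sub_self])
    obtain ⟨r', rfl⟩ := hD.extend T hT r
    exact ⟨biprod.desc s r', by simp [φ, hr]⟩

end IsProper

/-! ### Proper coresolutions -/

/-- There is an `X`-proper short exact sequence `0 ⟶ A ⟶ V ⟶ B ⟶ 0` with `V` in `Y`. -/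
def Linked (X Y : ObjectProperty C) (A B : C) : Prop :=
  ∃ (V : C) (f : A ⟶ V) (g : V ⟶ B), Y V ∧ IsProper X f g

lemma Linked.mono {X X' Y Y' : ObjectProperty C} (hX : X' ≤ X) (hY : Y ≤ Y') {A B : C}
    (h : Linked X Y A B) : Linked X' Y' A B := by
  obtain ⟨V, f, g, hV, hfg⟩ := h
  exact ⟨V, f, g, hY V hV, hfg.anti hX⟩

lemma Linked.op {X Y : ObjectProperty C} {A B : C} (h : Linked X Y A B) :
    Linked X.op Y.op (Opposite.op B) (Opposite.op A) := by
  obtain ⟨V, f, g, hV, hfg⟩ := h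
  exact ⟨Opposite.op V, g.op, f.op, hV, hfg.op⟩

lemma Linked.unop {X Y : ObjectProperty C} {A B : Cᵒᵖ} (h : Linked X.op Y.op A B) :
    Linked X Y B.unop A.unop := by
  obtain ⟨V, f, g, hV, hfg⟩ := h
  exact ⟨V.unop, g.unop, f.unop, hV, hfg.unop⟩

lemma Linked.of_iso {X Y : ObjectProperty C} {A A' B : C} (e : A' ≅ A) (h : Linked X Y A B) :
    Linked X Y A' B := by
  obtain ⟨V, f, g, hV, hfg⟩ := h
  exact ⟨V, _, g, hV, hfg.iso_comp e⟩

/-- The objects `M` with an exact coresolution `0 ⟶ M ⟶ V₀ ⟶ V₁ ⟶ ⋯` by objects of `Y` which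
is exact under `Hom(T, -)` and `Hom(-, T)` for every `T` in `X`. The coresolution is encoded by
the sequence `R` of its cosyzygies, with `R 0 ≅ M`. -/
def coresolvable (X Y : ObjectProperty C) : ObjectProperty C :=
  fun M => ∃ R : ℕ → C, Nonempty (M ≅ R 0) ∧ ∀ n, Linked X Y (R n) (R (n + 1))

lemma coresolvable.exists_linked {X Y : ObjectProperty C} {M : C} (h : coresolvable X Y M) :
    ∃ N, coresolvable X Y N ∧ Linked X Y M N := by
  obtain ⟨R, ⟨e⟩, hR⟩ := h
  exact ⟨R 1, ⟨fun n => R (n + 1), ⟨Iso.refl _⟩, fun n => hR (n + 1)⟩, (hR 0).of_iso e⟩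

lemma coresolvable_mono {X X' Y Y' : ObjectProperty C} (hX : X' ≤ X) (hY : Y ≤ Y') :
    coresolvable X Y ≤ coresolvable X' Y' := by
  rintro M ⟨R, e, hR⟩
  exact ⟨R, e, fun n => (hR n).mono hX hY⟩

/-- Coinduction: `coresolvable X Y` is the largest property `P` such that every object with `P`
is linked to another one. -/
lemma le_coresolvable {X Y P : ObjectProperty C} (hP : ∀ A, P A → ∃ B, P B ∧ Linked X Y A B) :
    P ≤ coresolvable X Y := by
  intro M hM
  choose next hnext hlink using hP
  let R : ℕ → Subtype P :=
    fun n => Nat.rec ⟨M, hM⟩ (fun _ A => ⟨next A.1 A.2, hnext A.1 A.2⟩) n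
  exact ⟨fun n => (R n).1, ⟨Iso.refl _⟩, fun n => hlink (R n).1 (R n).2⟩

lemma le_coresolvable_self {X : ObjectProperty C} (hX : ∀ Z, IsZero Z → X Z) :
    X ≤ coresolvable X X :=
  le_coresolvable fun A hA =>
    ⟨0, hX _ (isZero_zero C), A, 𝟙 A, 0, hA, IsProper.id_zero X A (isZero_zero C)⟩

/-- Coresolvable objects are closed under proper extensions, by iterating the horseshoe lemma. -/
lemma coresolvable_of_isProper {X : ObjectProperty C} (hX : IsSubcategory X) {A B D : C}
    {f : A ⟶ B} {g : B ⟶ D} (h : IsProper X f g) (hA : coresolvable X X A)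
    (hD : coresolvable X X D) : coresolvable X X B := by
  let P : ObjectProperty C := fun B => ∃ (A D : C) (f : A ⟶ B) (g : B ⟶ D),
    IsProper X f g ∧ coresolvable X X A ∧ coresolvable X X D
  refine le_coresolvable (P := P) ?_ B ⟨A, D, f, g, h, hA, hD⟩
  rintro B ⟨A, D, f, g, h, hA, hD⟩
  obtain ⟨A₁, hA₁, V, a, a', hV, ha⟩ := hA.exists_linked
  obtain ⟨D₁, hD₁, V', d, d', hV', hd⟩ := hD.exists_linked
  obtain ⟨B₁, φ, c, m, q, hφ, hmq⟩ := h.exists_horseshoe ha hd hV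
  exact ⟨B₁, ⟨A₁, D₁, m, q, hmq, hA₁, hD₁⟩, V ⊞ V', φ, c, hX.biprod_mem _ _ hV hV', hφ⟩

/-- A proper coresolution by coresolvable objects can be replaced by one by objects of `X`. The
coinduction runs over the proper extensions `U` of a coresolvable object `Q` by an object `N` of
the left-hand side: embedding `N` first into a coresolvable object and then into an object `V`
of `X`, and `Q` into an object `V'` of `X`, yields an embedding of `U` into `V ⊞ V'` whose
cokernel is again such an extension. -/
lemma coresolvable_coresolvable_le {X : ObjectProperty C} (hX : IsSubcategory X) :
    coresolvable X (coresolvable X X) ≤ coresolvable X X := by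
  let P : ObjectProperty C := fun U => ∃ (N Q : C) (f : N ⟶ U) (g : U ⟶ Q),
    IsProper X f g ∧ coresolvable X (coresolvable X X) N ∧ coresolvable X X Q
  intro M hM
  refine le_coresolvable (P := P) ?_ M ⟨M, 0, 𝟙 M, 0, IsProper.id_zero X M (isZero_zero C), hM,
    le_coresolvable_self hX.zero_mem _ (hX.zero_mem _ (isZero_zero C))⟩
  rintro U ⟨N, Q, f, g, h, hN, hQ⟩
  obtain ⟨N₁, hN₁, Y, n, n', hY, hn⟩ := hN.exists_linked
  obtain ⟨Y₁, hY₁, V, y, y', hV, hy⟩ := hY.exists_linked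
  obtain ⟨Q₁, hQ₁, V', d, d', hV', hd⟩ := hQ.exists_linked
  obtain ⟨T, c, k, q, hc, hkq⟩ := hn.exists_comp hy
  obtain ⟨U₁, φ, π, m, r, hφ, hmr⟩ := h.exists_horseshoe hc hd hV
  obtain ⟨E, s, k', q', hs, hkq'⟩ := hkq.exists_comp hmr
  exact ⟨U₁, ⟨N₁, E, _, s, hs, hN₁, coresolvable_of_isProper hX hkq' hY₁ hQ₁⟩,
    V ⊞ V', φ, π, hX.biprod_mem _ _ hV hV', hφ⟩

/-! ### Totally acyclic complexes as spliced proper sequences -/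

lemma homFrom_acyclic_iff (A : C) (K : ChainComplex C ℤ) :
    (homFrom A K).Acyclic ↔ ∀ (i : ℤ) (x : A ⟶ K.X (i + 1)), x ≫ K.d (i + 1) i = 0 →
      ∃ y : A ⟶ K.X (i + 1 + 1), y ≫ K.d (i + 1 + 1) (i + 1) = x := by
  have key (i : ℤ) : (homFrom A K).ExactAt (i + 1) ↔
      ∀ x : A ⟶ K.X (i + 1), x ≫ K.d (i + 1) i = 0 →
        ∃ y : A ⟶ K.X (i + 1 + 1), y ≫ K.d (i + 1 + 1) (i + 1) = x := by
    rw [HomologicalComplex.exactAt_iff' _ (i + 1 + 1) (i + 1) i (by simp) (by simp),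
      ShortComplex.ab_exact_iff]
    rfl
  refine ⟨fun h i => (key i).1 (h _), fun h i => ?_⟩
  obtain ⟨j, rfl⟩ : ∃ j, i = j + 1 := ⟨i - 1, by ring⟩
  exact (key j).2 (h j)

lemma homTo_acyclic_iff (K : ChainComplex C ℤ) (A : C) :
    (homTo K A).Acyclic ↔ ∀ (i : ℤ) (x : K.X (i + 1) ⟶ A), K.d (i + 1 + 1) (i + 1) ≫ x = 0 →
      ∃ y : K.X i ⟶ A, K.d (i + 1) i ≫ y = x := by
  have key (i : ℤ) : (homTo K A).ExactAt (i + 1) ↔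
      ∀ x : K.X (i + 1) ⟶ A, K.d (i + 1 + 1) (i + 1) ≫ x = 0 →
        ∃ y : K.X i ⟶ A, K.d (i + 1) i ≫ y = x := by
    rw [HomologicalComplex.exactAt_iff' _ i (i + 1) (i + 1 + 1)
      (ComplexShape.prev_eq' _ rfl) (ComplexShape.next_eq' _ rfl),
      ShortComplex.ab_exact_iff]
    rfl
  refine ⟨fun h i => (key i).1 (h _), fun h i => ?_⟩
  obtain ⟨j, rfl⟩ : ∃ j, i = j + 1 := ⟨i - 1, by ring⟩
  exact (key j).2 (h j)

lemma acyclic_iff (K : ChainComplex C ℤ) :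
    K.Acyclic ↔ ∀ i : ℤ, (ShortComplex.mk (K.d (i + 1 + 1) (i + 1)) (K.d (i + 1) i)
      (K.d_comp_d _ _ _)).Exact := by
  have key (i : ℤ) := K.exactAt_iff' (i + 1 + 1) (i + 1) i (by simp) (by simp)
  refine ⟨fun h i => (key i).1 (h _), fun h i => ?_⟩
  obtain ⟨j, rfl⟩ : ∃ j, i = j + 1 := ⟨i - 1, by ring⟩
  exact (key j).2 (h j)

/-- The objects of `G(X)` are those occurring in a doubly infinite sequence of linked objects,
namely the sequence of syzygies of a totally acyclic complex. -/
lemma gorenstein_iff_exists_linked (X : ObjectProperty C) (M : C) :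
    gorenstein X M ↔
      ∃ Z : ℤ → C, Nonempty (M ≅ Z 0) ∧ ∀ i, Linked X X (Z (i + 1)) (Z i) := by
  constructor
  · rintro ⟨K, hK, ⟨e⟩⟩
    refine ⟨fun i => cokernel (K.d (i + 1) i), ⟨by beta_reduce; rwa [zero_add]⟩, fun i => ?_⟩
    have hex := (acyclic_iff K).1 hK.exact
    let ι : cokernel (K.d (i + 1 + 1) (i + 1)) ⟶ K.X i :=
      cokernel.desc _ (K.d (i + 1) i) (K.d_comp_d _ _ _)
    have hι : cokernel.π _ ≫ ι = K.d (i + 1) i := cokernel.π_desc _ _ _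
    have : Mono ι := (hex i).mono_cokernelDesc
    refine ⟨K.X i, ι, cokernel.π _, hK.mem i, IsProper.of_desc ?_ (fun T x hx => ?_)
      (fun T hT t => ?_) (fun T hT t => ?_)⟩
    · rw [← cancel_epi (cokernel.π _), ← Category.assoc, hι, cokernel.condition, comp_zero]
    · exact ⟨cokernel.desc _ x (by rw [← hι, Category.assoc, hx, comp_zero]), cokernel.π_desc _ _ _⟩
    · obtain ⟨j, rfl⟩ : ∃ j, i = j + 1 := ⟨i - 1, by ring⟩
      let κ : cokernel (K.d (j + 1 + 1) (j + 1)) ⟶ K.X j :=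
        cokernel.desc _ (K.d (j + 1) j) (K.d_comp_d _ _ _)
      have hκ : cokernel.π _ ≫ κ = K.d (j + 1) j := cokernel.π_desc _ _ _
      have : Mono κ := (hex j).mono_cokernelDesc
      obtain ⟨l, rfl⟩ : ∃ l, j = l + 1 := ⟨j - 1, by ring⟩
      obtain ⟨y, hy⟩ := (homFrom_acyclic_iff T K).1 (hK.homFrom_exact T hT) l (t ≫ κ) (by
        rw [Category.assoc]
        have : κ ≫ K.d (l + 1) l = 0 := by
          rw [← cancel_epi (cokernel.π _), ← Category.assoc, hκ, K.d_comp_d, comp_zero]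
        rw [this, comp_zero])
      exact ⟨y, by rw [← cancel_mono κ, Category.assoc, hκ, hy]⟩
    · obtain ⟨y, hy⟩ := (homTo_acyclic_iff K T).1 (hK.homTo_exact T hT) i (cokernel.π _ ≫ t)
        (by rw [← Category.assoc, cokernel.condition, zero_comp])
      exact ⟨y, by rw [← cancel_epi (cokernel.π _), ← Category.assoc, hι, hy]⟩
  · rintro ⟨Z, ⟨e⟩, hZ⟩
    choose V f g hV hfg using hZ
    have (i : ℤ) : Mono (f i) := (hfg i).mono
    have (i : ℤ) : Epi (g i) := (hfg i).epi
    let d (i : ℤ) : V (i + 1) ⟶ V i := g (i + 1) ≫ f i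
    have hd (i : ℤ) : d (i + 1) ≫ d i = 0 := by
      simp only [d, Category.assoc]
      rw [← Category.assoc (f (i + 1)), (hfg (i + 1)).zero, zero_comp, comp_zero]
    let K : ChainComplex C ℤ := ChainComplex.of V d hd
    have hKd (i : ℤ) : K.d (i + 1) i = d i := ChainComplex.of_d _ _ _
    have hlift (i : ℤ) (T : C) (x : T ⟶ V (i + 1)) (hx : x ≫ d i = 0) :
        ∃ y : T ⟶ Z (i + 1 + 1), y ≫ f (i + 1) = x := by
      refine (hfg (i + 1)).exists_lift_kernel x ?_
      rwa [← cancel_mono (f i), zero_comp, Category.assoc]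
    refine ⟨K, ⟨hV, ?_, fun T hT => ?_, fun T hT => ?_⟩, ?_⟩
    · refine (acyclic_iff K).2 fun i => ?_
      rw [ShortComplex.exact_iff_exact_up_to_refinements]
      intro T x hx
      obtain ⟨y, hy⟩ := hlift i T x (by rw [← hKd]; exact hx)
      obtain ⟨T', ε, hε, z, hz⟩ := surjective_up_to_refinements_of_epi (g (i + 1 + 1)) y
      refine ⟨T', ε, hε, z, ?_⟩
      have h : ε ≫ x = z ≫ d (i + 1) := by rw [← hy, ← Category.assoc, hz, Category.assoc]
      exact h.trans (congrArg (z ≫ ·) (hKd (i + 1)).symm)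
    · refine (homFrom_acyclic_iff T K).2 fun i x hx => ?_
      obtain ⟨y, hy⟩ := hlift i T x (by rw [← hKd]; exact hx)
      obtain ⟨z, hz⟩ := (hfg (i + 1 + 1)).lift T hT y
      refine ⟨z, ?_⟩
      rw [hKd, ← hy, ← hz, Category.assoc]
    · refine (homTo_acyclic_iff K T).2 fun i x hx => ?_
      rw [hKd] at hx
      obtain ⟨y, hy⟩ := (hfg (i + 1)).exists_desc_cokernel x (by
        rw [← cancel_epi (g (i + 1 + 1)), ← Category.assoc, comp_zero]
        exact hx)
      obtain ⟨z, hz⟩ := (hfg i).extend T hT y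
      refine ⟨z, ?_⟩
      rw [hKd, ← hy, ← hz, Category.assoc]
    · -- `Z 0` is the cokernel of `∂₁ = g 1 ≫ f 0`, as `g 1` is an epimorphism.
      have hd0 : K.d 1 0 = g 1 ≫ f 0 := hKd 0
      obtain ⟨y, hy⟩ := (hfg 0).exists_desc_cokernel (T := cokernel (K.d 1 0))
        (cokernel.π (K.d 1 0)) (by
          rw [← cancel_epi (g 1), ← Category.assoc, comp_zero]
          exact (congrArg (· ≫ cokernel.π (K.d 1 0)) hd0).symm.trans (cokernel.condition _))
      have hdg : K.d 1 0 ≫ g 0 = 0 :=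
        (congrArg (· ≫ g 0) hd0).trans (by rw [Category.assoc, (hfg 0).zero, comp_zero])
      have hπ : cokernel.π (K.d 1 0) ≫ cokernel.desc (K.d 1 0) (g 0) hdg = g 0 :=
        cokernel.π_desc _ _ _
      exact ⟨e ≪≫
        { hom := y
          inv := cokernel.desc (K.d 1 0) (g 0) hdg
          hom_inv_id := by
            rw [← cancel_epi (g 0), ← Category.assoc, hy, hπ, Category.comp_id]
          inv_hom_id := by
            rw [← cancel_epi (cokernel.π (K.d 1 0)), ← Category.assoc, hπ, hy, Category.comp_id] }⟩

/-- An object lies in `G(X)` if and only if it has a proper coresolution and, dually, a proper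
resolution by objects of `X`. -/
lemma gorenstein_iff_coresolvable (X : ObjectProperty C) (M : C) :
    gorenstein X M ↔ coresolvable X X M ∧ coresolvable X.op X.op (op M) := by
  rw [gorenstein_iff_exists_linked]
  constructor
  · rintro ⟨Z, ⟨e⟩, hZ⟩
    refine ⟨⟨fun n => Z (-n), ⟨e⟩, fun n => ?_⟩,
      ⟨fun n => op (Z n), ⟨e.symm.op⟩, fun n => (hZ n).op⟩⟩
    have h := hZ (-(n + 1 : ℕ))
    rwa [show -((n + 1 : ℕ) : ℤ) + 1 = -n by push_cast; ring] at h
  · rintro ⟨⟨R, ⟨e⟩, hR⟩, ⟨L, ⟨e'⟩, hL⟩⟩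
    -- The two sequences are glued at `L 0`, which is isomorphic to `M` and hence to `R 0`.
    let Z : ℤ → C
      | Int.ofNat n => (L n).unop
      | Int.negSucc n => R (n + 1)
    refine ⟨Z, ⟨e'.symm.unop⟩, fun i => ?_⟩
    rcases i with n | _ | n
    · exact (hL n).unop
    · exact (hR 0).of_iso (e'.unop ≪≫ e)
    · exact hR (n + 1)

/-! ### Stability -/

lemma IsSubcategory.op {X : ObjectProperty C} (hX : IsSubcategory X) : IsSubcategory X.op where
  closedUnderIsomorphisms :=
    have := hX.closedUnderIsomorphisms
    inferInstance
  zero_mem _ hZ := hX.zero_mem _ hZ.unop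
  biprod_mem A B hA hB :=
    have := hX.closedUnderIsomorphisms
    X.op.prop_of_iso (biprod.opIso A.unop B.unop) (hX.biprod_mem _ _ hA hB)

lemma le_gorenstein {X : ObjectProperty C} (hX : ∀ Z, IsZero Z → X Z) : X ≤ gorenstein X :=
  fun M hM => (gorenstein_iff_coresolvable X M).2
    ⟨le_coresolvable_self hX M hM,
      le_coresolvable_self (X := X.op) (fun _ hZ => hX _ hZ.unop) (op M) hM⟩

lemma gorenstein_gorenstein {X : ObjectProperty C} (hX : IsSubcategory X) :
    gorenstein (gorenstein X) = gorenstein X := by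
  have hle := le_gorenstein hX.zero_mem
  refine le_antisymm (fun M hM => ?_) (le_gorenstein fun Z hZ => hle Z (hX.zero_mem Z hZ))
  rw [gorenstein_iff_coresolvable] at hM ⊢
  exact ⟨coresolvable_coresolvable_le hX M (coresolvable_mono hle
      (fun N hN => ((gorenstein_iff_coresolvable X N).1 hN).1) M hM.1),
    coresolvable_coresolvable_le hX.op (op M) (coresolvable_mono (fun N hN => hle N.unop hN)
      (fun N hN => ((gorenstein_iff_coresolvable X N.unop).1 hN).2) (op M) hM.2)⟩

end GorensteinSubcategory

theorem mainTheorem2 {C : Type u} [Category.{v} C] [Abelian C] [HasExt.{w} C]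
    (W : ObjectProperty C) (hW : GorensteinSubcategory.IsSubcategory W)
    (hWW : GorensteinSubcategory.Perp.{w} W W) (n : ℕ) (hn : 1 ≤ n) :
    GorensteinSubcategory.gorensteinIter W n = GorensteinSubcategory.gorenstein W := by
  induction n, hn using Nat.le_induction with
  | base => rfl
  | succ n _ ih =>
    rw [GorensteinSubcategory.gorensteinIter, ih, GorensteinSubcategory.gorenstein_gorenstein hW]
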